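/- Rings are associative, but not assumed to be commutative or to contain $1$; compact spaces and topological rings are Hausdorff by convention, and ``countable'' means finite or countably infinite. A ring is null if $xy=0$ for all its elements $x,y$. A \emph{compact $G$-ring} is a pair $(R,G)$, where $G$ is a Polish group acting faithfully, continuously (i.e. the map $G\times R\to R$ is continuous) and by ring automorphisms on a compact topological ring $R$, so that the stabilizers of all elements of $R$ are closed subgroups of $G$. It is \emph{small} if for every $n\in\omega$ there are only countably many orbits on $R^n$ under the (diagonal) action of $G$. A ring $R$ is \emph{null-by-finite} if it has a two-sided ideal of finite index which is a null ring. It is \emph{countable-by-null-by-countable} if there are a subring $R_1$ of $R$ whose additive group has countable index in $R^+$, and a countable two-sided ideal $I_1$ of $R_1$, such that the ring $R_1/I_1$ is null. \textbf{Corollary.} Let $(R,G)$ be a small compact $G$-ring. If $R$ is countable-by-null-by-countable, then $R$ is null-by-finite. -/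

import Mathlib

/-- `(X, G)` is a Polish structure: `G` is a Polish group acting faithfully on the set `X` so that
the stabilizers of all singletons are closed subgroups of `G`. -/
structure IsPolishStructure (G X : Type*) [Group G] [TopologicalSpace G] [MulAction G X] :
    Prop where
  isTopologicalGroup : IsTopologicalGroup G
  polishSpace : PolishSpace G
  faithful : FaithfulSMul G X
  isClosed_stabilizer : ∀ x : X, IsClosed (MulAction.stabilizer G x : Set G)

/-- `(X, G)` is small: for every `n` there are only countably many orbits on `X ^ n` under the
(diagonal) action of `G`. -/
def IsSmallStructure (G X : Type*) [Group G] [MulAction G X] : Prop :=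
  ∀ n : ℕ, Countable (MulAction.orbitRel.Quotient G (Fin n → X))

/-- `(R, G)` is a compact `G`-ring: a Polish structure in which `G` acts continuously (jointly) and
by ring automorphisms on a compact Hausdorff topological ring `R`. Rings are associative, not
necessarily commutative or unital. -/
structure IsCompactGRing (G R : Type*) [Group G] [TopologicalSpace G] [NonUnitalRing R]
    [TopologicalSpace R] [MulAction G R] : Prop extends IsPolishStructure G R where
  isTopologicalRing : IsTopologicalRing R
  compactSpace : CompactSpace R
  t2Space : T2Space R
  continuousSMul : ContinuousSMul G R
  smul_add : ∀ (g : G) (r s : R), g • (r + s) = g • r + g • s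
  smul_mul : ∀ (g : G) (r s : R), g • (r * s) = (g • r) * (g • s)

/-- An element `r` of a ring `R` is null if `rR = Rr = {0}`. -/
def IsNullElement {R : Type*} [NonUnitalRing R] (r : R) : Prop :=
  ∀ s : R, r * s = 0 ∧ s * r = 0

/-- A ring is null if all its elements are. -/
def IsNullRing (R : Type*) [NonUnitalRing R] : Prop :=
  ∀ r : R, IsNullElement r

/-- `R` is null-by-finite: it has a two-sided ideal of finite index which is a null ring. -/
def IsNullByFinite (R : Type*) [NonUnitalRing R] : Prop :=
  ∃ I : TwoSidedIdeal R, IsNullRing I ∧ Finite I.ringCon.Quotient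

/-- `R` is countable-by-null-by-countable: it has a subring `S` of countable index (of additive
groups), and `S` has a countable two-sided ideal `J` such that the ring `S / J` is null.
Countable means finite or countably infinite. -/
def IsCountableByNullByCountable (R : Type*) [NonUnitalRing R] : Prop :=
  ∃ S : NonUnitalSubring R, Countable (R ⧸ S.toAddSubgroup) ∧
    ∃ J : TwoSidedIdeal S, Countable J ∧ IsNullRing J.ringCon.Quotient

open Filter Topology

/-! The Baire category theorem is applied twice to the compact Hausdorff group `R`. If `r ∈ S`, then
`r S` lies in the countable set `J`, so countably many closed subsets of cosets of the right
annihilator of `r` cover `R`; hence that annihilator is open. Smallness and separability of `G` then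
give countably many open subgroups `U i` such that each `r ∈ S` annihilates some `U i` from the
left. The cosets of `S` being countably many, countably many translates of the closed left
annihilators `L i` of the `U i` cover `R`, so some `L i` is open. Then `V = L i ⊓ U i` is open with
`V * V = 0`, and by compactness it contains an open ideal, which has finite index. -/

section TopologicalAddGroup

variable {A ι : Type*} [AddCommGroup A] [TopologicalSpace A] [IsTopologicalAddGroup A]
  [BaireSpace A]

/-- If a Baire group is covered by countably many closed sets, each contained in a coset of a
subgroup, then one of these subgroups is open. -/
theorem AddSubgroup.exists_isOpen_of_iUnion_closed [Countable ι] (H : ι → AddSubgroup A)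
    (f : ι → Set A) (hc : ∀ i, IsClosed (f i)) (hU : ∀ x, ∃ i, x ∈ f i)
    (hf : ∀ i, ∀ x ∈ f i, ∀ y ∈ f i, y - x ∈ H i) : ∃ i, IsOpen (H i : Set A) := by
  obtain ⟨i, x, hx⟩ := nonempty_interior_of_iUnion_of_closed hc
    (Set.eq_univ_of_forall fun x ↦ Set.mem_iUnion.2 (hU x))
  refine ⟨i, (H i).isOpen_of_mem_nhds (g := 0) ?_⟩
  have ht : Tendsto (fun z ↦ z + x) (𝓝 0) (𝓝 x) :=
    (continuous_id.add continuous_const).tendsto' _ _ (zero_add x)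
  filter_upwards [ht (mem_interior_iff_mem_nhds.1 hx)] with z hz
  simpa using hf i x (interior_subset hx) _ hz

end TopologicalAddGroup

section Annihilator

variable {R : Type*} [NonUnitalRing R]

/-- The right annihilator of an element, as an additive subgroup. -/
def rightAnnihilator (r : R) : AddSubgroup R where
  carrier := {y | r * y = 0}
  zero_mem' := mul_zero r
  add_mem' {a b} (ha : r * a = 0) (hb : r * b = 0) := show r * (a + b) = 0 by
    rw [mul_add, ha, hb, add_zero]
  neg_mem' {a} (ha : r * a = 0) := show r * -a = 0 by rw [mul_neg, ha, neg_zero]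

theorem mem_rightAnnihilator {r y : R} : y ∈ rightAnnihilator r ↔ r * y = 0 := Iff.rfl

/-- The left annihilator of a set, as an additive subgroup. -/
def leftAnnihilator (U : Set R) : AddSubgroup R where
  carrier := {x | ∀ y ∈ U, x * y = 0}
  zero_mem' y _ := zero_mul y
  add_mem' {a b} ha hb y hy := by rw [add_mul, ha y hy, hb y hy, add_zero]
  neg_mem' {a} ha y hy := by rw [neg_mul, ha y hy, neg_zero]

theorem mem_leftAnnihilator {U : Set R} {x : R} :
    x ∈ leftAnnihilator U ↔ ∀ y ∈ U, x * y = 0 := Iff.rfl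

theorem isClosed_leftAnnihilator [TopologicalSpace R] [ContinuousMul R] [T2Space R] (U : Set R) :
    IsClosed (leftAnnihilator U : Set R) := by
  have : (leftAnnihilator U : Set R) = ⋂ y ∈ U, {x | x * y = 0} := by
    ext x
    simp [mem_leftAnnihilator]
  rw [this]
  exact isClosed_biInter fun y _ ↦
    isClosed_eq (continuous_id.mul continuous_const) continuous_const

end Annihilator

section CompactRing

variable {R : Type*} [NonUnitalRing R] [TopologicalSpace R] [IsTopologicalRing R] [CompactSpace R]

/-- Every open additive subgroup of a compact ring contains an open two-sided ideal. -/
theorem AddSubgroup.exists_twoSidedIdeal_subset (V : AddSubgroup R) (hV : IsOpen (V : Set R)) :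
    ∃ I : TwoSidedIdeal R, IsOpen (I : Set R) ∧ ∀ x ∈ I, x ∈ V := by
  -- The largest two-sided ideal inside `V`; without a unit, all four conditions are needed.
  let I : TwoSidedIdeal R := TwoSidedIdeal.mk'
    {x | x ∈ V ∧ (∀ a, a * x ∈ V) ∧ (∀ b, x * b ∈ V) ∧ ∀ a b, a * x * b ∈ V}
    (by simp [V.zero_mem])
    (by
      rintro x y ⟨h₁, h₂, h₃, h₄⟩ ⟨k₁, k₂, k₃, k₄⟩
      refine ⟨V.add_mem h₁ k₁, fun a ↦ ?_, fun b ↦ ?_, fun a b ↦ ?_⟩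
      · rw [mul_add]; exact V.add_mem (h₂ a) (k₂ a)
      · rw [add_mul]; exact V.add_mem (h₃ b) (k₃ b)
      · rw [mul_add, add_mul]; exact V.add_mem (h₄ a b) (k₄ a b))
    (by
      rintro x ⟨h₁, h₂, h₃, h₄⟩
      simpa using ⟨h₁, h₂, h₃, h₄⟩)
    (by
      rintro c x ⟨h₁, h₂, h₃, h₄⟩
      refine ⟨h₂ c, fun a ↦ ?_, h₄ c, fun a b ↦ ?_⟩
      · rw [← mul_assoc]; exact h₂ _
      · rw [← mul_assoc]; exact h₄ _ _)
    (by
      rintro x c ⟨h₁, h₂, h₃, h₄⟩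
      refine ⟨h₃ c, fun a ↦ ?_, fun b ↦ ?_, fun a b ↦ ?_⟩
      · rw [← mul_assoc]; exact h₄ _ _
      · rw [mul_assoc]; exact h₃ _
      · rw [← mul_assoc, mul_assoc]; exact h₄ _ _)
  have hI : ∀ x, x ∈ I ↔ x ∈ V ∧ (∀ a, a * x ∈ V) ∧ (∀ b, x * b ∈ V) ∧ ∀ a b, a * x * b ∈ V :=
    fun x ↦ TwoSidedIdeal.mem_mk' ..
  refine ⟨I, ?_, fun x hx ↦ ((hI x).1 hx).1⟩
  refine (AddSubgroup.ofClass I).isOpen_of_mem_nhds (g := 0) ?_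
  -- Tube lemma: `{0} × K` is mapped to `0 ∈ V`, and `K` is compact.
  have key {K : Type _} [TopologicalSpace K] [CompactSpace K] (f : R → K → R)
      (hf : Continuous f.uncurry) (h0 : ∀ k, f 0 k = 0) : ∀ᶠ x in 𝓝 (0 : R), ∀ k, f x k ∈ V := by
    have := isCompact_univ.eventually_forall_of_forall_eventually (x₀ := (0 : R)) (K := Set.univ)
      (P := fun x k ↦ f x k ∈ V) fun k _ ↦
        hf.continuousAt.eventually (hV.mem_nhds (by simp [h0, V.zero_mem]))
    simpa using this
  filter_upwards [hV.mem_nhds V.zero_mem, key (fun x a ↦ a * x) (by fun_prop) (by simp),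
    key (fun x b ↦ x * b) (by fun_prop) (by simp),
    key (fun x (p : R × R) ↦ p.1 * x * p.2) (by fun_prop) (by simp)] with x h₁ h₂ h₃ h₄
  exact (hI x).2 ⟨h₁, h₂, h₃, fun a b ↦ h₄ (a, b)⟩

theorem TwoSidedIdeal.finite_quotient_of_isOpen (I : TwoSidedIdeal R) (hI : IsOpen (I : Set R)) :
    Finite I.ringCon.Quotient := by
  have := (AddSubgroup.ofClass I).quotient_finite_of_isOpen hI
  let f : R ⧸ AddSubgroup.ofClass I → I.ringCon.Quotient :=
    Quotient.lift (fun x : R ↦ (x : I.ringCon.Quotient)) fun a b hab ↦ by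
      have h : -a + b ∈ I := QuotientAddGroup.leftRel_apply.1 hab
      refine (RingCon.eq _).2 (I.ringCon.symm ((I.rel_iff b a).2 ?_))
      rwa [sub_eq_neg_add]
  refine Finite.of_surjective f fun q ↦ ?_
  induction q using Quotient.inductionOn' with
  | h x => exact ⟨QuotientAddGroup.mk x, rfl⟩

theorem isNullByFinite_of_isOpen (V : AddSubgroup R) (hV : IsOpen (V : Set R))
    (hmul : ∀ x ∈ V, ∀ y ∈ V, x * y = 0) : IsNullByFinite R := by
  obtain ⟨I, hI, hIV⟩ := V.exists_twoSidedIdeal_subset hV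
  refine ⟨I, fun r s ↦ ⟨?_, ?_⟩, I.finite_quotient_of_isOpen hI⟩
  · exact Subtype.ext (hmul _ (hIV _ r.2) _ (hIV _ s.2))
  · exact Subtype.ext (hmul _ (hIV _ s.2) _ (hIV _ r.2))

variable [T2Space R]

/-- If `r S` is countable for a subgroup `S` of countable index in a compact ring, then the right
annihilator of `r` is open. -/
theorem isOpen_rightAnnihilator_of_countable (S : AddSubgroup R) [Countable (R ⧸ S)] {J : Set R}
    (hJ : J.Countable) {r : R} (hr : ∀ s ∈ S, r * s ∈ J) :
    IsOpen (rightAnnihilator r : Set R) := by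
  have := hJ.to_subtype
  have hcont (t : R) : Continuous fun x ↦ r * (x - t) := by fun_prop
  -- The pieces are indexed by the coset of `x`, with representative `t`, and the value `r * (x - t)
  -- ∈ J`.
  obtain ⟨_, h⟩ := AddSubgroup.exists_isOpen_of_iUnion_closed (ι := (R ⧸ S) × J)
    (fun _ ↦ rightAnnihilator r) (fun i ↦ {x | r * (x - i.1.out) = i.2})
    (fun i ↦ isClosed_eq (hcont _) continuous_const)
    (fun x ↦ ⟨((x : R ⧸ S), ⟨_, hr (x - (x : R ⧸ S).out) (by
      rw [sub_eq_neg_add]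
      exact QuotientAddGroup.eq.1 (Quotient.out_eq' _))⟩), rfl⟩)
    (by
      rintro i x (hx : _ = _) y (hy : _ = _)
      rw [mem_rightAnnihilator, ← sub_sub_sub_cancel_right y x i.1.out, mul_sub, hx, hy, sub_self])
  exact h

end CompactRing

theorem TwoSidedIdeal.mul_mem_of_isNullRing_quotient {S : Type*} [NonUnitalRing S]
    {J : TwoSidedIdeal S} (hJ : IsNullRing J.ringCon.Quotient) (r s : S) : r * s ∈ J :=
  (J.mem_iff _).2 ((RingCon.eq _).1 (hJ (r : J.ringCon.Quotient) (s : J.ringCon.Quotient)).1)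

theorem IsSmallStructure.countable_orbits {G X : Type*} [Group G] [MulAction G X]
    (h : IsSmallStructure G X) : Countable (MulAction.orbitRel.Quotient G X) := by
  have := h 1
  let f : MulAction.orbitRel.Quotient G (Fin 1 → X) → MulAction.orbitRel.Quotient G X :=
    Quotient.map (fun v ↦ v 0) (by
      rintro _ v ⟨g, rfl⟩
      exact ⟨g, rfl⟩)
  refine Function.Surjective.countable (f := f) fun q ↦ ?_
  induction q using Quotient.inductionOn' with
  | h x => exact ⟨Quotient.mk'' fun _ ↦ x, rfl⟩

namespace IsCompactGRing

variable {G R : Type*} [Group G] [TopologicalSpace G] [NonUnitalRing R] [TopologicalSpace R]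
  [MulAction G R]

theorem smul_zero (hR : IsCompactGRing G R) (g : G) : g • (0 : R) = 0 := by
  simpa using hR.smul_add g 0 0

theorem mem_rightAnnihilator_smul (hR : IsCompactGRing G R) (g : G) (r y : R) :
    y ∈ rightAnnihilator (g • r) ↔ g⁻¹ • y ∈ rightAnnihilator r := by
  rw [mem_rightAnnihilator, mem_rightAnnihilator]
  constructor
  · intro h
    have := hR.smul_mul g⁻¹ (g • r) y
    rwa [h, hR.smul_zero, inv_smul_smul, eq_comm] at this
  · intro h
    have := hR.smul_mul g r (g⁻¹ • y)
    rwa [h, hR.smul_zero, smul_inv_smul, eq_comm] at this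

/-- Openness of the annihilator depends only on the orbit, so it can be tested on a chosen
representative. -/
theorem isOpen_rightAnnihilator_smul_iff (hR : IsCompactGRing G R) (g : G) (r : R) :
    IsOpen (rightAnnihilator (g • r) : Set R) ↔ IsOpen (rightAnnihilator r : Set R) := by
  have := hR.continuousSMul
  have : (rightAnnihilator (g • r) : Set R) = (g⁻¹ • ·) ⁻¹' (rightAnnihilator r : Set R) :=
    Set.ext fun y ↦ hR.mem_rightAnnihilator_smul g r y
  rw [this]
  exact (Homeomorph.smul g⁻¹).isOpen_preimage

/-- An open right annihilator does not grow under translation by elements of `G` near `1`. -/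
theorem eventually_rightAnnihilator_smul_le (hR : IsCompactGRing G R) {r : R}
    (hr : IsOpen (rightAnnihilator r : Set R)) :
    ∀ᶠ h : G in 𝓝 1, rightAnnihilator (h • r) ≤ rightAnnihilator r := by
  have := hR.continuousSMul
  have := hR.compactSpace
  have := hR.isTopologicalRing
  -- An open subgroup is closed, hence compact here, so one neighbourhood of `1` moves none of its
  -- points out of it.
  have hU := (AddSubgroup.isClosed_of_isOpen _ hr).isCompact
  have := hU.eventually_forall_of_forall_eventually (x₀ := (1 : G))
    (P := fun h y ↦ h • y ∈ rightAnnihilator r) fun y hy ↦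
      continuous_smul.continuousAt.eventually (hr.mem_nhds (by simpa using hy))
  filter_upwards [this] with h hh y hy
  simpa using hh _ ((hR.mem_rightAnnihilator_smul h r y).1 hy)

end IsCompactGRing

theorem mainTheorem11 {G R : Type*} [Group G] [TopologicalSpace G] [NonUnitalRing R]
    [TopologicalSpace R] [MulAction G R] (hR : IsCompactGRing G R) (hsmall : IsSmallStructure G R)
    (hcnc : IsCountableByNullByCountable R) : IsNullByFinite R := by
  have := hR.isTopologicalGroup
  have := hR.polishSpace
  have := hR.isTopologicalRing
  have := hR.compactSpace
  have := hR.t2Space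
  have := hsmall.countable_orbits
  obtain ⟨S, hS, J, hJ, hnull⟩ := hcnc
  have hopen : ∀ r ∈ S, IsOpen (rightAnnihilator r : Set R) := fun r hr ↦
    isOpen_rightAnnihilator_of_countable S.toAddSubgroup (J := (↑) '' (J : Set S))
      ((Set.to_countable (J : Set S)).image _) fun s hs ↦
        ⟨⟨r, hr⟩ * ⟨s, hs⟩, TwoSidedIdeal.mul_mem_of_isNullRing_quotient hnull _ _, rfl⟩
  obtain ⟨D, hDc, hD⟩ := TopologicalSpace.exists_countable_dense G
  have := hDc.to_subtype
  let O := {o : MulAction.orbitRel.Quotient G R // IsOpen (rightAnnihilator o.out : Set R)}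
  let U (i : (R ⧸ S.toAddSubgroup) × O × D) : AddSubgroup R :=
    rightAnnihilator ((i.2.2 : G) • i.2.1.1.out)
  let L (i : (R ⧸ S.toAddSubgroup) × O × D) : AddSubgroup R := leftAnnihilator (U i : Set R)
  obtain ⟨i, hi⟩ := AddSubgroup.exists_isOpen_of_iUnion_closed L
    (fun i ↦ (fun x ↦ x - i.1.out) ⁻¹' (L i : Set R))
    (fun i ↦ (isClosed_leftAnnihilator _).preimage (continuous_id.sub continuous_const))
    (by
      intro x
      let c : R ⧸ S.toAddSubgroup := x
      have hx : x - c.out ∈ S := by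
        rw [sub_eq_neg_add]
        exact QuotientAddGroup.eq.1 (Quotient.out_eq' c)
      set r := x - c.out with hr
      let o : MulAction.orbitRel.Quotient G R := Quotient.mk'' r
      obtain ⟨g, hg⟩ : ∃ g : G, g • r = o.out := Quotient.exact (Quotient.out_eq' o)
      have ho : IsOpen (rightAnnihilator o.out : Set R) := by
        rw [← hg, hR.isOpen_rightAnnihilator_smul_iff]
        exact hopen r hx
      -- Since `d • o.out = (d * g) • r`, a `d ∈ D` close to `g⁻¹` brings the representative back
      -- near `r`.
      have hnear : ∀ᶠ d : G in 𝓝 g⁻¹, rightAnnihilator ((d * g) • r) ≤ rightAnnihilator r :=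
        ((continuous_id.mul continuous_const).tendsto' g⁻¹ 1 (inv_mul_cancel g)).eventually
          (hR.eventually_rightAnnihilator_smul_le (hopen r hx))
      obtain ⟨d, hd, hdD⟩ := mem_closure_iff_nhds.1 (hD g⁻¹) _ hnear
      refine ⟨(c, ⟨o, ho⟩, ⟨d, hdD⟩), fun y hy ↦ ?_⟩
      refine hd ?_
      rw [mul_smul, hg]
      exact hy)
    (by
      intro i x hx y hy
      simpa using (L i).sub_mem hy hx)
  have hUi : IsOpen (U i : Set R) := (hR.isOpen_rightAnnihilator_smul_iff _ _).2 i.2.1.2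
  exact isNullByFinite_of_isOpen (L i ⊓ U i) (hi.inter hUi)
    fun x hx y hy ↦ hx.1 y hy.2
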